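/- All groups are finite. For a group $G$, $\Phi(G)$ denotes the Frattini subgroup (the intersection of all maximal subgroups of $G$, equal to $G$ if there are none), $Soc(G)$ the socle (the subgroup generated by all minimal normal subgroups of $G$), and $\tilde F(G)$ the subgroup of $G$ defined by $\Phi(G)\le\tilde F(G)$ and $\tilde F(G)/\Phi(G)=Soc(G/\Phi(G))$. A subgroup functor is a function $\tau$ that assigns to each group $G$ a possibly empty set $\tau(G)$ of subgroups of $G$ such that $f(\tau(G))=\tau(f(G))$ for every isomorphism $f:G\to G^*$. It is called an $m$-functor if for every group $G$ the set $\tau(G)$ consists of $G$ itself and some (possibly no) maximal subgroups of $G$. Let $\Phi_\tau(G)$ be the intersection of all subgroups in $\tau(G)$; it is normal in $G$. Let $\tilde F_\tau(G)$ be the subgroup of $G$ defined by $\Phi_\tau(G)\le\tilde F_\tau(G)$ and $\tilde F_\tau(G)/\Phi_\tau(G)=Soc(G/\Phi_\tau(G))$. Proposition 3.8. Let $\tau$ be an $m$-functor and let $G$ be a finite group. Then $\tilde F(G)\le\tilde F_\tau(G)$. In particular, $C_G(\tilde F_\tau(G))\le\tilde F_\tau(G)$. -/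

import Mathlib

universe u

/-- A minimal normal subgroup: a nontrivial normal subgroup `N` such that the only normal
subgroups of the whole group lying in `N` are the trivial subgroup and `N`. -/
def IsMinimalNormal {G : Type u} [Group G] (N : Subgroup G) : Prop :=
  N.Normal ∧ N ≠ ⊥ ∧ ∀ K : Subgroup G, K.Normal → K ≤ N → K = ⊥ ∨ K = N

/-- The socle `Soc(G)`: the subgroup generated by all minimal normal subgroups of `G`. -/
def socle (G : Type u) [Group G] : Subgroup G :=
  sSup {N : Subgroup G | IsMinimalNormal N}

/-- For a normal subgroup `N` of `G`, the subgroup `S` of `G` with `N ≤ S` and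
`S / N = Soc(G / N)`, as the preimage of `Soc(G / N)` under the projection `G → G / N`. -/
def socleOver {G : Type u} [Group G] (N : Subgroup G) [N.Normal] : Subgroup G :=
  (socle (G ⧸ N)).comap (QuotientGroup.mk' N)

/-- `socleOver N` is the unique subgroup `S` with `N ≤ S` and `S / N = Soc(G / N)`. -/
theorem eq_socleOver_iff {G : Type u} [Group G] (N : Subgroup G) [N.Normal] (S : Subgroup G) :
    S = socleOver N ↔ N ≤ S ∧ S.map (QuotientGroup.mk' N) = socle (G ⧸ N) := by
  constructor
  · rintro rfl
    refine ⟨?_, Subgroup.map_comap_eq_self_of_surjective (QuotientGroup.mk'_surjective N) _⟩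
    intro x hx
    have h : QuotientGroup.mk' N x = 1 := (QuotientGroup.eq_one_iff x).2 hx
    rw [socleOver, Subgroup.mem_comap, h]
    exact one_mem _
  · rintro ⟨h, h'⟩
    rw [socleOver, ← h', Subgroup.comap_map_eq, QuotientGroup.ker_mk', sup_eq_left.2 h]

/-- The subgroup `F̃(G)`: `Φ(G) ≤ F̃(G)` and `F̃(G) / Φ(G) = Soc(G / Φ(G))`, where `Φ(G)` is the
Frattini subgroup. -/
def FTilde (G : Type u) [Group G] : Subgroup G :=
  socleOver (frattini G)

/-- A subgroup functor assigns to each finite group `G` a (possibly empty) set of subgroups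
of `G`, such that `f (τ G) = τ (f G)` for every isomorphism `f : G → H`. -/
structure SubgroupFunctor where
  obj : ∀ (G : Type u) [Group G] [Finite G], Set (Subgroup G)
  image_obj : ∀ (G H : Type u) [Group G] [Finite G] [Group H] [Finite H] (f : G ≃* H),
    (fun K : Subgroup G => K.map f.toMonoidHom) '' obj G = obj H

namespace SubgroupFunctor

/-- An m-functor: for every finite group `G`, the set `τ G` consists of `G` itself and some
(possibly no) maximal subgroups of `G`. -/
def IsMFunctor (τ : SubgroupFunctor.{u}) : Prop :=
  ∀ (G : Type u) [Group G] [Finite G],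
    ⊤ ∈ τ.obj G ∧ ∀ H ∈ τ.obj G, H = ⊤ ∨ IsCoatom H

/-- `Φ_τ(G)`: the intersection of all subgroups in `τ G`. -/
def Phi (τ : SubgroupFunctor.{u}) (G : Type u) [Group G] [Finite G] : Subgroup G :=
  sInf (τ.obj G)

/-- `Φ_τ(G)` is normal, because `τ G` is stable under inner automorphisms. -/
instance phi_normal (τ : SubgroupFunctor.{u}) (G : Type u) [Group G] [Finite G] :
    (τ.Phi G).Normal := by
  refine ⟨fun n hn g => ?_⟩
  rw [Phi, Subgroup.mem_sInf] at hn ⊢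
  intro K hK
  rw [← τ.image_obj G G (MulAut.conj g)] at hK
  obtain ⟨L, hL, rfl⟩ := hK
  exact ⟨n, hn L hL, rfl⟩

/-- The subgroup `F̃_τ(G)`: `Φ_τ(G) ≤ F̃_τ(G)` and `F̃_τ(G) / Φ_τ(G) = Soc(G / Φ_τ(G))`. -/
def FTilde (τ : SubgroupFunctor.{u}) (G : Type u) [Group G] [Finite G] : Subgroup G :=
  socleOver (τ.Phi G)

end SubgroupFunctor

/-! Members of `τ.obj G` are maximal or `⊤`, so Φ ≤ Φ_τ, and the surjection G/Φ → G/Φ_τ carries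
socle into socle (`socleOver_mono`). As centralizers reverse inclusions, it remains to bound
C_G(F̃(G)), which reduces to `centralizer_socle_le` in G/Φ. There, with C the centralizer of the
socle, the abelian normal subgroup Soc ∩ C has a complement M; C ∩ M is normal and meets the socle
trivially, so it is trivial, and C ≤ Soc. -/

/-- In a finite group every nontrivial normal subgroup contains a minimal normal subgroup. -/
theorem exists_isMinimalNormal_le {G : Type u} [Group G] [Finite G] (D : Subgroup G)
    [hD : D.Normal] (hne : D ≠ ⊥) : ∃ N : Subgroup G, IsMinimalNormal N ∧ N ≤ D := by
  obtain ⟨N, hND, hN⟩ := (Set.toFinite {K : Subgroup G | K.Normal ∧ K ≠ ⊥}).exists_le_minimal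
    (show D ∈ {K : Subgroup G | K.Normal ∧ K ≠ ⊥} from ⟨hD, hne⟩)
  refine ⟨N, ⟨hN.prop.1, hN.prop.2, fun K hK hKN => ?_⟩, hND⟩
  by_cases hb : K = ⊥
  · exact Or.inl hb
  · exact Or.inr (le_antisymm hKN (hN.le_of_le ⟨hK, hb⟩ hKN))

theorem eq_bot_of_disjoint_socle {G : Type u} [Group G] [Finite G] (D : Subgroup G)
    [D.Normal] (h : Disjoint D (socle G)) : D = ⊥ := by
  by_contra hne
  obtain ⟨N, hN, hND⟩ := exists_isMinimalNormal_le D hne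
  exact hN.2.1 (le_bot_iff.1 (h hND (le_sSup hN)))

instance socle_normal (G : Type u) [Group G] : (socle G).Normal := by
  refine ⟨fun n hn g => ?_⟩
  suffices h : socle G ≤ (socle G).comap (MulAut.conj g).toMonoidHom from h hn
  refine sSup_le fun N hN x hx => ?_
  exact le_sSup (a := N) hN (hN.1.conj_mem x hx g)

/-- A surjective homomorphism maps a minimal normal subgroup to the trivial subgroup or to a
minimal normal subgroup. -/
theorem IsMinimalNormal.map {G H : Type u} [Group G] [Group H] {N : Subgroup G}
    (hN : IsMinimalNormal N) {f : G →* H} (hf : Function.Surjective f) :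
    N.map f = ⊥ ∨ IsMinimalNormal (N.map f) := by
  by_cases hb : N.map f = ⊥
  · exact Or.inl hb
  refine Or.inr ⟨hN.1.map f hf, hb, fun K hK hKN => ?_⟩
  have := hN.1
  -- Minimality of `N` applies to this normal subgroup, which maps onto `K`.
  have hmap : (N ⊓ K.comap f).map f = K := by
    refine le_antisymm (Subgroup.map_le_iff_le_comap.2 inf_le_right) fun y hy => ?_
    obtain ⟨x, hx, rfl⟩ := hKN hy
    exact ⟨x, ⟨hx, hy⟩, rfl⟩
  rcases hN.2.2 (N ⊓ K.comap f) inferInstance inf_le_left with h | h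
  · left; rw [← hmap, h, Subgroup.map_bot]
  · right; rw [← hmap, h]

theorem map_socle_le {G H : Type u} [Group G] [Group H] {f : G →* H}
    (hf : Function.Surjective f) : (socle G).map f ≤ socle H := by
  rw [Subgroup.map_le_iff_le_comap]
  refine sSup_le fun N hN => Subgroup.map_le_iff_le_comap.1 ?_
  rcases hN.map hf with h | h
  · rw [h]; exact bot_le
  · exact le_sSup h

theorem socleOver_mono {G : Type u} [Group G] {M N : Subgroup G} [M.Normal] [N.Normal]
    (h : M ≤ N) : socleOver M ≤ socleOver N := by
  intro x hx
  have hsurj : Function.Surjective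
      (QuotientGroup.map M N (MonoidHom.id G) (h.trans_eq N.comap_id.symm)) := fun y => by
    obtain ⟨g, rfl⟩ := QuotientGroup.mk_surjective y
    exact ⟨g, rfl⟩
  exact map_socle_le hsurj ⟨_, hx, rfl⟩

/-- If `A` and `M` generate `G`, `C` is normal and `A` centralizes `C ⊓ M`, then `C ⊓ M` is
normal. -/
theorem normal_inf_of_sup_eq_top {G : Type u} [Group G] {A C M : Subgroup G} [C.Normal]
    (hAM : A ⊔ M = ⊤) (hcomm : ∀ a ∈ A, ∀ x ∈ C, x * a = a * x) : (C ⊓ M).Normal := by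
  -- The normalizer contains `A`, which centralizes `C ⊓ M`, and `M`, which normalizes both factors.
  rw [← Subgroup.normalizer_eq_top_iff, eq_top_iff, ← hAM]
  refine sup_le (fun a ha => ?_) (fun m hm => ?_)
  · exact Subgroup.centralizer_le_normalizer _
      (Subgroup.mem_centralizer_iff.2 fun x hx => hcomm a ha x hx.1)
  · rw [Subgroup.mem_normalizer_iff]
    intro x
    have h1 : x ∈ C ↔ m * x * m⁻¹ ∈ C := by
      have := Subgroup.normalizer_eq_top C ▸ Subgroup.mem_top m
      exact Subgroup.mem_normalizer_iff.1 this x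
    exact and_congr h1 (Subgroup.mem_normalizer_iff.1 (Subgroup.le_normalizer hm) x)

/-- An abelian normal subgroup of a finite group with trivial Frattini subgroup has a complement
(Gaschütz). -/
theorem exists_isCompl_of_frattini_eq_bot {G : Type u} [Group G] [Finite G]
    (hG : frattini G = ⊥) (A : Subgroup G) [A.Normal] [IsMulCommutative A] :
    ∃ M : Subgroup G, IsCompl A M := by
  -- A minimal supplement `M` of `A` is a complement: `A ⊓ M` lies in every maximal subgroup.
  obtain ⟨M, -, hM⟩ := (Set.toFinite {K : Subgroup G | A ⊔ K = ⊤}).exists_le_minimal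
    (show ⊤ ∈ {K : Subgroup G | A ⊔ K = ⊤} from sup_top_eq A)
  have hAM : A ⊔ M = ⊤ := hM.prop
  have hnormal : (A ⊓ M).Normal :=
    normal_inf_of_sup_eq_top hAM fun a ha x hx => setLike_mul_comm hx ha
  refine ⟨M, disjoint_iff.2 ?_, codisjoint_iff.2 hAM⟩
  rw [← le_bot_iff, ← hG]
  refine le_iInf₂ fun H hH => ?_
  by_contra hle
  have hsup : (A ⊓ M) ⊔ H = ⊤ := hH.2 _ (right_lt_sup.2 hle)
  -- In `m = a * h` with `a ∈ A ⊓ M`, also `h ∈ M`. So `H ⊓ M` supplements `A`, and minimality gives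
  -- `M ≤ H`.
  have hMle : M ≤ A ⊔ (H ⊓ M) := fun m hm => by
    obtain ⟨a, ha, h, hh, rfl⟩ := Subgroup.mem_sup_of_normal_left.1 (hsup ▸ Subgroup.mem_top m)
    exact mul_mem (Subgroup.mem_sup_left ha.1)
      (Subgroup.mem_sup_right ⟨hh, (M.mul_mem_cancel_left ha.2).1 hm⟩)
  have hmem : A ⊔ (H ⊓ M) = ⊤ := top_le_iff.1 (hAM ▸ sup_le le_sup_left hMle)
  have hMH : M ≤ H := (hM.le_of_le hmem inf_le_right).trans inf_le_left
  exact hle (inf_le_right.trans hMH)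

/-- In a finite group with trivial Frattini subgroup the socle contains its centralizer. -/
theorem centralizer_socle_le {G : Type u} [Group G] [Finite G] (hG : frattini G = ⊥) :
    Subgroup.centralizer (socle G : Set G) ≤ socle G := by
  set C := Subgroup.centralizer (socle G : Set G) with hC
  have hcomm : ∀ x ∈ C, ∀ s ∈ socle G, s * x = x * s := fun x hx s hs =>
    Subgroup.mem_centralizer_iff.1 hx s hs
  have : IsMulCommutative (socle G ⊓ C : Subgroup G) :=
    ⟨⟨fun x y => Subtype.ext (hcomm y y.2.2 x x.2.1)⟩⟩
  obtain ⟨M, hM⟩ := exists_isCompl_of_frattini_eq_bot hG (socle G ⊓ C)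
  have hD : (C ⊓ M).Normal :=
    normal_inf_of_sup_eq_top hM.sup_eq_top fun a ha x hx => (hcomm x hx a ha.1).symm
  have hbot : C ⊓ M = ⊥ := by
    refine eq_bot_of_disjoint_socle _ (disjoint_iff_inf_le.2 ?_)
    rintro x ⟨⟨hxC, hxM⟩, hxS⟩
    exact hM.disjoint.le_bot ⟨⟨hxS, hxC⟩, hxM⟩
  intro c hc
  -- Dedekind: `a ∈ C`, so the factor `m` lies in `C ⊓ M`, which is trivial.
  obtain ⟨a, ha, m, hm, rfl⟩ :=
    Subgroup.mem_sup_of_normal_left.1 (hM.sup_eq_top ▸ Subgroup.mem_top c)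
  have hm1 : m ∈ C ⊓ M := ⟨(C.mul_mem_cancel_left ha.2).1 hc, hm⟩
  rw [hbot, Subgroup.mem_bot] at hm1
  rw [hm1, mul_one]
  exact ha.1

theorem frattini_quotient_frattini (G : Type u) [Group G] : frattini (G ⧸ frattini G) = ⊥ := by
  have hsurj := QuotientGroup.mk'_surjective (frattini G)
  rw [eq_bot_iff]
  intro y hy
  obtain ⟨x, rfl⟩ := hsurj y
  refine Subgroup.mem_bot.2 ((QuotientGroup.eq_one_iff x).2 ?_)
  refine Subgroup.mem_iInf.2 fun H => Subgroup.mem_iInf.2 fun hH => ?_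
  have hker : (QuotientGroup.mk' (frattini G)).ker ≤ H :=
    (QuotientGroup.ker_mk' _).trans_le (frattini_le_coatom hH)
  have hcomap : (H.map (QuotientGroup.mk' (frattini G))).comap (QuotientGroup.mk' (frattini G)) = H :=
    Subgroup.comap_map_eq_self hker
  have hcoatom : IsCoatom (H.map (QuotientGroup.mk' (frattini G))) := by
    refine ⟨fun h => hH.1 ?_, fun K hK => ?_⟩
    · rw [← hcomap, h, Subgroup.comap_top]
    · have hlt := (Subgroup.comap_lt_comap_of_surjective hsurj).2 hK
      rw [hcomap] at hlt
      exact (Subgroup.comap_injective hsurj) ((hH.2 _ hlt).trans (Subgroup.comap_top _).symm)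
  rw [← hcomap]
  exact frattini_le_coatom hcoatom hy

theorem centralizer_fTilde_le (G : Type u) [Group G] [Finite G] :
    Subgroup.centralizer (FTilde G : Set G) ≤ FTilde G := by
  intro x hx
  refine centralizer_socle_le (frattini_quotient_frattini G)
    (Subgroup.mem_centralizer_iff.2 fun y hy => ?_)
  obtain ⟨s, rfl⟩ := QuotientGroup.mk'_surjective (frattini G) y
  rw [← map_mul, ← map_mul, Subgroup.mem_centralizer_iff.1 hx s hy]

theorem SubgroupFunctor.IsMFunctor.frattini_le_phi {τ : SubgroupFunctor.{u}} (hτ : τ.IsMFunctor)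
    (G : Type u) [Group G] [Finite G] : frattini G ≤ τ.Phi G := by
  refine le_sInf fun H hH => ?_
  rcases (hτ G).2 H hH with rfl | h
  · exact le_top
  · exact frattini_le_coatom h

theorem proposition3p8 (τ : SubgroupFunctor.{u}) (hτ : τ.IsMFunctor)
    (G : Type u) [Group G] [Finite G] :
    _root_.FTilde G ≤ τ.FTilde G ∧
      Subgroup.centralizer (τ.FTilde G : Set G) ≤ τ.FTilde G := by
  have hle : _root_.FTilde G ≤ τ.FTilde G := socleOver_mono (hτ.frattini_le_phi G)
  exact ⟨hle, (Subgroup.centralizer_le hle).trans ((centralizer_fTilde_le G).trans hle)⟩
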